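/- **Definitions.** Enumerate every infinite $M\subseteq\mathbb N$ increasingly as $M(1)<M(2)<\cdots$ and every finite $s\subset\mathbb N$ as $s(1)<\dots<s(|s|)$; write $t\sqsubseteq s$ if $t$ is an initial segment of $s$. For a family $\mathcal F$ of finite subsets of $\mathbb N$ put $\widehat{\mathcal F}=\{t:\ t\sqsubseteq s\text{ for some }s\in\mathcal F\}$ and $\mathcal F\upharpoonright M=\{s\in\mathcal F:\ s\subseteq M\}$. The family $\mathcal F$ is *regular thin* if no member of $\mathcal F$ is an initial segment of a different member, and $\widehat{\mathcal F}$ is compact (the characteristic functions of its members form a closed subset of $\{0,1\}^{\mathbb N}$), hereditary (closed under subsets) and spreading (if $\{n_1<\dots<n_k\}\in\widehat{\mathcal F}$, $m_1<\dots<m_k$ and $n_i\le m_i$ for all $i$, then $\{m_1,\dots,m_k\}\in\widehat{\mathcal F}$). A tuple $(s_j)_{j=1}^{l}$ of nonempty finite subsets of $\mathbb N$ is *plegma* if $s_i(k)<s_j(k)$ whenever $i<j$ and $1\le k\le\min(|s_i|,|s_j|)$, and $s_i(k)<s_j(k+1)$ for all $i,j$ and all $1\le k\le\min(|s_i|,|s_j|-1)$.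 An $\mathcal F$-sequence in a set $X$ is a map $s\mapsto x_s$ from $\mathcal F$ to $X$; its restriction to $\mathcal F\upharpoonright M$ ($M$ infinite) is an $\mathcal F$-subsequence, and its further subsequences are the restrictions to $\mathcal F\upharpoonright L$ with $L\subseteq M$ infinite. In a metric space, $(x_s)_{s\in\mathcal F\upharpoonright L}$ is *Cauchy* if for every $\varepsilon>0$ there is $m$ with $\rho(x_s,x_t)<\varepsilon$ for all $s,t\in\mathcal F\upharpoonright L$ with $\min s,\min t\ge L(m)$; it *converges to* $x$ if for every open $U\ni x$ there is $m$ with $x_s\in U$ for all $s\in\mathcal F\upharpoonright L$ with $\min s\ge L(m)$; it is *plegma $\varepsilon$-separated* if $\rho(x_s,x_t)>\varepsilon$ for every plegma pair $(s,t)$ in $\mathcal F\upharpoonright L$. Let $(E,\|\cdot\|_*)$ be a real seminormed space with Hamel basis $(e_n)_{n\ge1}$. The subsequence $(x_s)_{s\in\mathcal F\upharpoonright M}$ of an $\mathcal F$-sequence in a Banach space $X$ *generates $(e_n)$ as an $\mathcal F$-spreading model* if there is a null sequence $(\delta_n)$ of positive reals such that $$\Bigl|\,\Bigl\|\sum_{j=1}^k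 a_jx_{s_j}\Bigr\|-\Bigl\|\sum_{j=1}^k a_je_j\Bigr\|_*\Bigr|\le\delta_l$$ for all $1\le k\le l$, every plegma $k$-tuple $(s_j)_{j=1}^k$ in $\mathcal F\upharpoonright M$ with $s_1(1)\ge M(l)$ and all $a_1,\dots,a_k\in[-1,1]$. The sequence $(e_n)$ is *trivial* if $\|\sum_{i=1}^n a_ie_i\|_*=|\sum_{i=1}^n a_i|\cdot\|e_1\|_*$ for all $n$ and all real $a_1,\dots,a_n$. **Theorem.** Let $\mathcal F$ be a regular thin family with $\mathcal F\ne\emptyset$ and $\mathcal F\neq\{\emptyset\}$, let $M\subseteq\mathbb N$ be infinite, let $(x_s)_{s\in\mathcal F}$ be an $\mathcal F$-sequence in a real Banach space $X$, and let $(E,\|\cdot\|_*)$ be a real seminormed space with Hamel basis $(e_n)_{n\ge1}$ such that $(x_s)_{s\in\mathcal F\upharpoonright M}$ generates $(e_n)$ as an $\mathcal F$-spreading model. The following are equivalent: 1. $\|\cdot\|_*$ is not a norm on $E$, i.e. there is $z\neq0$ in $E$ with $\|z\|_*=0$. 2. $(e_n)$ is trivial. 3. For every regular thin family $\mathcal G$,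 every infinite-dimensional real Banach space $Y$ and every constant $\mathcal G$-sequence $(y_t)_{t\in\mathcal G}$ in $Y$ with $\|y_t\|=\|e_1\|_*$ for all $t\in\mathcal G$, the sequence $(y_t)_{t\in\mathcal G}$ generates $(e_n)$ as a $\mathcal G$-spreading model. 4. There is an infinite $L\subseteq M$ such that $(x_s)_{s\in\mathcal F\upharpoonright L}$ is norm Cauchy. 5. For every $\varepsilon>0$ and every infinite $L\subseteq M$, $(x_s)_{s\in\mathcal F\upharpoonright L}$ is not plegma $\varepsilon$-separated. 6. There is $x\in X$ such that for every infinite $L\subseteq M$ there is an infinite $L'\subseteq L$ for which $(x_s)_{s\in\mathcal F\upharpoonright L'}$ converges to $x$. -/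

import Mathlib

open Filter Topology

universe u v w

namespace FSpreading

/-- `elt A k` is the `k`-th element of `A ⊆ ℕ` in increasing order, counting from `k = 0`.
It is meaningful for every `k` if `A` is infinite, and for `k < |A|` if `A` is finite. -/
noncomputable def elt (A : Set ℕ) (k : ℕ) : ℕ := Nat.nth (fun n => n ∈ A) k

/-- `t ⊑ s`: the finite set `t` is an initial segment of `s`. -/
def InitSeg (t s : Finset ℕ) : Prop := t ⊆ s ∧ ∀ n ∈ s, ∀ m ∈ t, n ≤ m → n ∈ t

/-- The closure of a family: all initial segments of its members. -/
def hat (F : Set (Finset ℕ)) : Set (Finset ℕ) := {t | ∃ s ∈ F, InitSeg t s}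

def Thin (F : Set (Finset ℕ)) : Prop := ∀ s ∈ F, ∀ t ∈ F, InitSeg s t → s = t

def Hereditary (F : Set (Finset ℕ)) : Prop := ∀ s ∈ F, ∀ t, t ⊆ s → t ∈ F

def Spreading (F : Set (Finset ℕ)) : Prop :=
  ∀ s ∈ F, ∀ t : Finset ℕ, t.card = s.card →
    (∀ k < s.card, elt (s : Set ℕ) k ≤ elt (t : Set ℕ) k) → t ∈ F

/-- The characteristic functions of the members of `F` form a closed subset of the Cantor
space. -/
def CompactFamily (F : Set (Finset ℕ)) : Prop :=
  IsClosed {f : ℕ → Bool | ∃ s ∈ F, ∀ n, f n = true ↔ n ∈ s}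

def Regular (F : Set (Finset ℕ)) : Prop := CompactFamily F ∧ Hereditary F ∧ Spreading F

def RegularThin (F : Set (Finset ℕ)) : Prop := Thin F ∧ Regular (hat F)

/-- A tuple of nonempty finite sets is plegma if its entries interlace: the first elements come
first, in the order of the tuple, then the second elements, and so on. -/
def Plegma {l : ℕ} (s : Fin l → Finset ℕ) : Prop :=
  (∀ i, (s i).Nonempty) ∧
  (∀ i j, i < j → ∀ k, k < (s i).card → k < (s j).card →
    elt (s i : Set ℕ) k < elt (s j : Set ℕ) k) ∧
  (∀ i j, ∀ k, k < (s i).card → k + 1 < (s j).card →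
    elt (s i : Set ℕ) k < elt (s j : Set ℕ) (k + 1))

/-- An `F`-sequence in `X` is a map `x : F → X`; its subsequence indexed by the members of `F`
contained in `M` generates `e` as an `F`-spreading model with respect to the seminorm `p`.
As indices start at `0`, the tuples have `k + 1 ≤ l + 1` entries and `elt M l` is the
`(l + 1)`-st element of `M`. -/
def Generates {X E : Type*} [NormedAddCommGroup X] [NormedSpace ℝ X] [AddCommGroup E]
    [Module ℝ E] (p : Seminorm ℝ E) (e : ℕ → E) (F : Set (Finset ℕ)) (x : F → X)
    (M : Set ℕ) : Prop :=
  ∃ δ : ℕ → ℝ, (∀ n, 0 < δ n) ∧ Tendsto δ atTop (𝓝 0) ∧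
    ∀ k l : ℕ, k ≤ l → ∀ s : Fin (k + 1) → F, (∀ j, ((s j : Finset ℕ) : Set ℕ) ⊆ M) →
      Plegma (fun j => (s j : Finset ℕ)) → (∀ n ∈ (s 0 : Finset ℕ), elt M l ≤ n) →
      ∀ a : Fin (k + 1) → ℝ, (∀ j, a j ∈ Set.Icc (-1 : ℝ) 1) →
        |‖∑ j, a j • x (s j)‖ - p (∑ j, a j • e j)| ≤ δ l

/-- Trivial sequences in a seminormed space. -/
def TrivialSeq {E : Type*} [AddCommGroup E] [Module ℝ E] (p : Seminorm ℝ E) (e : ℕ → E) :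
    Prop :=
  ∀ (n : ℕ) (a : Fin n → ℝ), p (∑ i, a i • e i) = |∑ i, a i| * p (e 0)

/-- The subsequence of `x` indexed by the members of `F` contained in `M` is Cauchy. -/
def CauchyAlong {X : Type*} [MetricSpace X] (F : Set (Finset ℕ)) (x : F → X) (M : Set ℕ) :
    Prop :=
  ∀ ε > 0, ∃ m : ℕ, ∀ s t : F, ((s : Finset ℕ) : Set ℕ) ⊆ M → ((t : Finset ℕ) : Set ℕ) ⊆ M →
    (∀ n ∈ (s : Finset ℕ), elt M m ≤ n) → (∀ n ∈ (t : Finset ℕ), elt M m ≤ n) →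
      dist (x s) (x t) < ε

/-- The subsequence of `x` indexed by the members of `F` contained in `M` converges to `x₀`. -/
def ConvergesAlong {X : Type*} [TopologicalSpace X] (F : Set (Finset ℕ)) (x : F → X)
    (M : Set ℕ) (x₀ : X) : Prop :=
  ∀ U : Set X, IsOpen U → x₀ ∈ U → ∃ m : ℕ, ∀ s : F, ((s : Finset ℕ) : Set ℕ) ⊆ M →
    (∀ n ∈ (s : Finset ℕ), elt M m ≤ n) → x s ∈ U

/-- The subsequence of `x` indexed by the members of `F` contained in `L` is plegma
`ε`-separated. -/
def PlegmaSeparated {X : Type*} [MetricSpace X] (ε : ℝ) (F : Set (Finset ℕ)) (x : F → X)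
    (L : Set ℕ) : Prop :=
  ∀ s t : F, ((s : Finset ℕ) : Set ℕ) ⊆ L → ((t : Finset ℕ) : Set ℕ) ⊆ L →
    Plegma ![(s : Finset ℕ), (t : Finset ℕ)] → ε < dist (x s) (x t)

end FSpreading

namespace FSpreading

/-! Every condition is equivalent to `p (e 0 - e 1) = 0`: along plegma pairs far out in `M`, the
distance of the terms tends to this number. If it vanishes, plegma pairs `(s 0, s i)` give `p (e i -
e 0) = 0` for all `i`, so the sequence is trivial. Conversely, if a combination with `a i ≠ 0` has
seminorm zero, evaluate it on two plegma tuples that differ only in entry `i`; subtracting isolates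
`a i` times the difference of a plegma pair.

The metric core is `PlegmaClose.exists_cauchyAlong`: closeness along plegma pairs upgrades to the
Cauchy property on an infinite subset. Two members need not be plegma, but each can be joined by a
chain of plegma pairs to a common far-out member, and the errors along the chain sum geometrically.

All members of `F` needed on the way are found by `RegularThin.exists_large`: inside a suitable
infinite set, every increasing sequence has an initial segment in `F`. Interlacing sequences then
yield plegma tuples. -/

/-! ### Finite sets as initial pieces of increasing sequences -/

theorem elt_image_range {f : ℕ → ℕ} {n k : ℕ} (hf : StrictMonoOn f (Set.Iio n)) (hk : k < n) :
    elt ((Finset.range n).image f : Finset ℕ) k = f k := by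
  classical
  have hmem : f k ∈ (Finset.range n).image f :=
    Finset.mem_image_of_mem f (Finset.mem_range.2 hk)
  have hcount : Nat.count (fun m => m ∈ (((Finset.range n).image f : Finset ℕ) : Set ℕ)) (f k)
      = k := by
    rw [Nat.count_eq_card_filter_range]
    have : (Finset.range (f k)).filter
        (fun m => m ∈ (((Finset.range n).image f : Finset ℕ) : Set ℕ))
        = (Finset.range k).image f := by
      ext m
      simp only [Finset.mem_filter, Finset.mem_range, Finset.coe_image, Set.mem_image,
        Finset.mem_coe, Finset.mem_image]
      constructor
      · rintro ⟨hm, i, hi, rfl⟩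
        exact ⟨i, (hf.lt_iff_lt hi hk).1 hm, rfl⟩
      · rintro ⟨i, hi, rfl⟩
        exact ⟨hf (hi.trans hk) hk hi, i, hi.trans hk, rfl⟩
    rw [this, Finset.card_image_of_injOn, Finset.card_range]
    intro i hi j hj hij
    exact hf.injOn (by simp at hi ⊢; omega) (by simp at hj ⊢; omega) hij
  have := Nat.nth_count (p := fun m => m ∈ (((Finset.range n).image f : Finset ℕ) : Set ℕ))
    (n := f k) (by exact_mod_cast hmem)
  rw [hcount] at this
  exact this

theorem card_image_range {f : ℕ → ℕ} {n : ℕ} (hf : StrictMonoOn f (Set.Iio n)) :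
    ((Finset.range n).image f).card = n := by
  rw [Finset.card_image_of_injOn, Finset.card_range]
  simpa using hf.injOn

theorem image_elt_range (s : Finset ℕ) :
    (Finset.range s.card).image (elt (s : Set ℕ)) = s := by
  have hfin : (Set.ofPred (fun n => n ∈ (s : Set ℕ))).Finite := s.finite_toSet
  have hs : hfin.toFinset = s := by ext; simp
  have := Nat.image_nth_Iio_card hfin
  rw [hs] at this
  apply Finset.coe_injective
  rw [Finset.coe_image, Finset.coe_range]
  exact this

theorem strictMonoOn_elt (s : Finset ℕ) :
    StrictMonoOn (elt (s : Set ℕ)) (Set.Iio s.card) := by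
  have hfin : (Set.ofPred (fun n => n ∈ (s : Set ℕ))).Finite := s.finite_toSet
  have hs : hfin.toFinset = s := by ext; simp
  have := Nat.nth_strictMonoOn hfin
  rwa [hs] at this

theorem elt_mem_of_infinite {A : Set ℕ} (hA : A.Infinite) (k : ℕ) : elt A k ∈ A :=
  Nat.nth_mem_of_infinite (p := fun n => n ∈ A) hA k

theorem le_elt_of_infinite {A : Set ℕ} (hA : A.Infinite) (k : ℕ) : k ≤ elt A k :=
  (Nat.nth_strictMono (p := fun n => n ∈ A) hA).le_apply

/-! ### Infinite sets on which the family is large -/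

/-- Every infinite subset of `N` has an initial segment in `F`. -/
def Large (F : Set (Finset ℕ)) (N : Set ℕ) : Prop :=
  ∀ a : ℕ → ℕ, StrictMono a → (∀ i, a i ∈ N) → ∃ n, (Finset.range n).image a ∈ F

theorem Large.mono {F : Set (Finset ℕ)} {N N' : Set ℕ} (h : Large F N) (hN : N' ⊆ N) :
    Large F N' := fun a ha haN => h a ha fun i => hN (haN i)

theorem exists_insert_mem_hat {F : Set (Finset ℕ)} {t : Finset ℕ} (ht : t ∈ hat F)
    (htF : t ∉ F) : ∃ m, (∀ i ∈ t, i < m) ∧ insert m t ∈ hat F := by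
  obtain ⟨s, hs, hts, hinit⟩ := ht
  have hne : (s \ t).Nonempty := by
    rw [Finset.sdiff_nonempty]
    intro hst
    exact htF (hts.antisymm hst ▸ hs)
  have hmem := Finset.mem_sdiff.1 ((s \ t).min'_mem hne)
  refine ⟨(s \ t).min' hne, fun i hi => ?_, s, hs, ?_, ?_⟩
  · by_contra hcon
    exact hmem.2 (hinit _ hmem.1 i hi (not_lt.1 hcon))
  · exact Finset.insert_subset hmem.1 hts
  · intro n hn m hm hnm
    by_contra hcon
    rw [Finset.mem_insert, not_or] at hcon
    have hle := (s \ t).min'_le n (Finset.mem_sdiff.2 ⟨hn, hcon.2⟩)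
    rcases Finset.mem_insert.1 hm with rfl | hm
    · exact hcon.1 (le_antisymm hnm hle)
    · exact hcon.2 (hinit n hn m hm hnm)

theorem image_range_update {a : ℕ → ℕ} {n m : ℕ} :
    (Finset.range (n + 1)).image (Function.update a n m)
      = insert m ((Finset.range n).image a) := by
  rw [Finset.range_add_one, Finset.image_insert, Function.update_self]
  congr 1
  refine Finset.image_congr fun i hi => ?_
  rw [Function.update_of_ne (by simp at hi; omega)]

theorem Spreading.image_range_succ_mem {F : Set (Finset ℕ)} (hF : Spreading F) {a : ℕ → ℕ}
    (ha : StrictMono a) {n m : ℕ} (hm : ∀ i ∈ (Finset.range n).image a, i < m)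
    (hmF : insert m ((Finset.range n).image a) ∈ F) (hma : m ≤ a n) :
    (Finset.range (n + 1)).image a ∈ F := by
  have hu : StrictMonoOn (Function.update a n m) (Set.Iio (n + 1)) := by
    intro i hi j hj hij
    simp only [Set.mem_Iio] at hi hj
    rw [Function.update_of_ne (by omega)]
    rcases eq_or_ne j n with rfl | hjn
    · rw [Function.update_self]
      exact hm _ (Finset.mem_image_of_mem _ (Finset.mem_range.2 hij))
    · rw [Function.update_of_ne hjn]
      exact ha hij
  rw [← image_range_update] at hmF
  have haOn := ha.strictMonoOn (Set.Iio (n + 1))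
  refine hF _ hmF _ (by rw [card_image_range hu, card_image_range haOn]) fun k hk => ?_
  rw [card_image_range hu] at hk
  rw [elt_image_range hu hk, elt_image_range haOn hk]
  rcases eq_or_ne k n with rfl | hkn
  · rwa [Function.update_self]
  · rw [Function.update_of_ne hkn]

/-- The initial pieces of `a` converge pointwise to the range of `a`, which is infinite and so
cannot be a limit inside a closed family of finite sets. -/
theorem CompactFamily.exists_image_range_notMem {F : Set (Finset ℕ)} (hF : CompactFamily F)
    {a : ℕ → ℕ} (ha : StrictMono a) : ∃ n, (Finset.range n).image a ∉ F := by
  classical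
  by_contra! h
  have hlim : Tendsto (fun n : ℕ => fun i : ℕ => decide (i ∈ (Finset.range n).image a)) atTop
      (𝓝 fun i => decide (i ∈ Set.range a)) := by
    rw [tendsto_pi_nhds]
    intro i
    refine tendsto_const_nhds.congr' ?_
    filter_upwards [eventually_gt_atTop i] with n hn
    simp only [Set.mem_range, Finset.mem_image, Finset.mem_range, decide_eq_decide]
    constructor
    · rintro ⟨j, rfl⟩
      exact ⟨j, ha.le_apply.trans_lt hn, rfl⟩
    · rintro ⟨j, -, rfl⟩
      exact ⟨j, rfl⟩
  obtain ⟨s, -, hs⟩ := IsClosed.mem_of_tendsto hF hlim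
    (Eventually.of_forall fun n => ⟨_, h n, fun i => by simp⟩)
  refine (Set.infinite_range_of_injective ha.injective) (s.finite_toSet.subset fun i hi => ?_)
  exact (hs i).1 (by simpa using hi)

/-- Each non-maximal `t ∈ hat F` has some admissible next element `m t`. If `N` grows fast enough to
dominate `m` on all earlier subsets, spreading keeps the initial pieces of a sequence in `N` inside
`hat F` until one of them lies in `F`; compactness forces this to happen. -/
theorem RegularThin.exists_large {F : Set (Finset ℕ)} (hF : RegularThin F) (hne : F.Nonempty)
    {M : Set ℕ} (hM : M.Infinite) : ∃ N ⊆ M, N.Infinite ∧ Large F N := by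
  obtain ⟨-, hcomp, -, hspread⟩ := hF
  have hex : ∀ t : Finset ℕ, ∃ m, t ∈ hat F → t ∉ F →
      (∀ i ∈ t, i < m) ∧ insert m t ∈ hat F := fun t => by
    by_cases h : t ∈ hat F ∧ t ∉ F
    · obtain ⟨m, hm⟩ := exists_insert_mem_hat h.1 h.2
      exact ⟨m, fun _ _ => hm⟩
    · exact ⟨0, fun h1 h2 => absurd ⟨h1, h2⟩ h⟩
  choose m hm using hex
  have hnext : ∀ n : ℕ, ∃ k ∈ M, n < k ∧ ∀ t ⊆ Finset.range (n + 1), m t ≤ k := fun n => by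
    obtain ⟨k, hkM, hk⟩ := hM.exists_gt (max n ((Finset.range (n + 1)).powerset.sup m))
    refine ⟨k, hkM, (le_max_left _ _).trans_lt hk, fun t ht => ?_⟩
    exact (Finset.le_sup (f := m) (Finset.mem_powerset.2 ht)).trans
      ((le_max_right _ _).trans hk.le)
  choose g hgM hg_lt hg using hnext
  -- By the choice of `g`, `φ (j + 1)` dominates `m t` for every `t` with elements at most `φ j`.
  let φ : ℕ → ℕ := fun n => Nat.rec (g 0) (fun _ k => g k) n
  have hφ : StrictMono φ := strictMono_nat_of_lt_succ fun n => hg_lt (φ n)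
  refine ⟨Set.range φ, ?_, Set.infinite_range_of_injective hφ.injective, ?_⟩
  · rintro _ ⟨n, rfl⟩
    cases n with
    | zero => exact hgM 0
    | succ n => exact hgM (φ n)
  · intro a ha haN
    by_contra! hcon
    have hmem : ∀ n, (Finset.range n).image a ∈ hat F := by
      intro n
      induction n with
      | zero =>
        obtain ⟨s, hs⟩ := hne
        exact ⟨s, hs, by simp [InitSeg]⟩
      | succ n ih =>
        obtain ⟨h1, h2⟩ := hm _ ih (hcon n)
        refine hspread.image_range_succ_mem ha h1 h2 ?_
        obtain ⟨j, hj⟩ := haN n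
        rw [← hj]
        cases j with
        | zero =>
          refine hg 0 _ fun i hi => ?_
          obtain ⟨k, hk, rfl⟩ := Finset.mem_image.1 hi
          obtain ⟨j', hj'⟩ := haN k
          have : j' < 0 := hφ.lt_iff_lt.1 (by rw [hj', hj]; exact ha (Finset.mem_range.1 hk))
          omega
        | succ j =>
          refine hg (φ j) _ fun i hi => ?_
          obtain ⟨k, hk, rfl⟩ := Finset.mem_image.1 hi
          obtain ⟨j', hj'⟩ := haN k
          have : j' < (j + 1) := hφ.lt_iff_lt.1 (by rw [hj', hj]; exact ha (Finset.mem_range.1 hk))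
          rw [Finset.mem_range, ← hj', Nat.lt_succ_iff]
          exact hφ.monotone (by omega)
    obtain ⟨n, hn⟩ := hcomp.exists_image_range_notMem ha
    exact hn (hmem n)

/-! ### Plegma tuples from interlaced sequences -/

theorem plegma_image_range {l : ℕ} {a : Fin l → ℕ → ℕ} {n : Fin l → ℕ}
    (ha : ∀ i, StrictMono (a i)) (hn : ∀ i, 0 < n i)
    (hlt : ∀ i j, i < j → ∀ k, a i k < a j k) (hsucc : ∀ i j k, a i k < a j (k + 1)) :
    Plegma fun i => (Finset.range (n i)).image (a i) := by
  have hOn := fun i => (ha i).strictMonoOn (Set.Iio (n i))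
  refine ⟨fun i => ?_, fun i j hij k hi hj => ?_, fun i j k hi hj => ?_⟩
  · simpa using (hn i).ne'
  · rw [card_image_range (hOn _)] at hi hj
    rw [elt_image_range (hOn i) hi, elt_image_range (hOn j) hj]
    exact hlt i j hij k
  · rw [card_image_range (hOn _)] at hi hj
    rw [elt_image_range (hOn i) hi, elt_image_range (hOn j) hj]
    exact hsucc i j k

theorem plegma_pair_image_range {a b : ℕ → ℕ} {n m : ℕ} (hn : 0 < n) (hm : 0 < m)
    (hab : ∀ k, a k < b k) (hba : ∀ k, b k < a (k + 1)) :
    Plegma ![(Finset.range n).image a, (Finset.range m).image b] := by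
  have ha : StrictMono a := strictMono_nat_of_lt_succ fun k => (hab k).trans (hba k)
  have hb : StrictMono b := strictMono_nat_of_lt_succ fun k => (hba k).trans (hab _)
  have := plegma_image_range (a := ![a, b]) (n := ![n, m])
    (by simp [Fin.forall_fin_two, ha, hb]) (by simp [Fin.forall_fin_two, hn, hm])
    (by simpa [Fin.forall_fin_two] using hab)
    (by simpa [Fin.forall_fin_two, hba, ha (Nat.lt_succ_self _), hb (Nat.lt_succ_self _)]
          using fun k => (hab k).trans (hb (Nat.lt_succ_self _)))
  convert this using 1
  ext i : 1
  fin_cases i <;> rfl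

theorem Plegma.comp {l l' : ℕ} {s : Fin l → Finset ℕ} (hs : Plegma s) {c : Fin l' → Fin l}
    (hc : StrictMono c) : Plegma fun i => s (c i) :=
  ⟨fun _ => hs.1 _, fun _ _ hij => hs.2.1 _ _ (hc hij), fun _ _ => hs.2.2 _ _⟩

theorem Plegma.pair {l : ℕ} {s : Fin l → Finset ℕ} (hs : Plegma s) {i j : Fin l} (hij : i < j) :
    Plegma ![s i, s j] := by
  have := hs.comp (c := ![i, j]) (by
    intro a b hab
    fin_cases a <;> fin_cases b <;> simp_all)
  convert this using 1
  ext a : 1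
  fin_cases a <;> rfl

theorem pos_of_image_range_mem {F : Set (Finset ℕ)} (hF : ∅ ∉ F) {a : ℕ → ℕ} {n : ℕ}
    (h : (Finset.range n).image a ∈ F) : 0 < n := by
  rcases Nat.eq_zero_or_pos n with rfl | hn
  · exact absurd (by simpa using h) hF
  · exact hn

theorem Large.exists_plegma {F : Set (Finset ℕ)} {N : Set ℕ} (hF : Large F N) (hN : N.Infinite)
    (hempty : ∅ ∉ F) (l m : ℕ) : ∃ s : Fin l → F, (∀ j, ((s j : Finset ℕ) : Set ℕ) ⊆ N) ∧
      Plegma (fun j => (s j : Finset ℕ)) ∧ ∀ j, ∀ n ∈ (s j : Finset ℕ), m ≤ n := by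
  have hN' := Nat.nth_strictMono (p := fun n => n ∈ N) hN
  -- The residue classes modulo `l` interlace; the offset `m` pushes every entry beyond `m`.
  let a : Fin l → ℕ → ℕ := fun j k => elt N (l * k + j + m)
  have ha : ∀ j, StrictMono (a j) := fun j => strictMono_nat_of_lt_succ fun k => hN' (by
    rw [Nat.mul_succ]; have := j.2; omega)
  choose n hn using fun j => hF (a j) (ha j) fun i => elt_mem_of_infinite hN _
  refine ⟨fun j => ⟨_, hn j⟩, fun j => ?_, plegma_image_range ha
    (fun i => pos_of_image_range_mem hempty (hn i)) (fun i j hij k => hN' ?_)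
    (fun i j k => hN' ?_), fun j i hi => ?_⟩
  · intro i hi
    obtain ⟨k, -, rfl⟩ := Finset.mem_image.1 (Finset.mem_coe.1 hi)
    exact elt_mem_of_infinite hN _
  · have : (i : ℕ) < j := hij
    omega
  · rw [Nat.mul_succ]
    have := i.2
    omega
  · obtain ⟨k, -, rfl⟩ := Finset.mem_image.1 hi
    exact le_trans (by omega) (le_elt_of_infinite hN _)


/-! ### From plegma closeness to Cauchy subsequences and limits -/

/-- Far out in `M`, the terms of `x` at plegma pairs are close to each other. -/
def PlegmaClose {X : Type*} [MetricSpace X] (F : Set (Finset ℕ)) (x : F → X) (M : Set ℕ) : Prop :=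
  ∀ ε > 0, ∃ m : ℕ, ∀ s t : F, ((s : Finset ℕ) : Set ℕ) ⊆ M → ((t : Finset ℕ) : Set ℕ) ⊆ M →
    (∀ n ∈ (s : Finset ℕ), m ≤ n) → Plegma ![(s : Finset ℕ), (t : Finset ℕ)] →
      dist (x s) (x t) < ε

theorem PlegmaClose.mono {X : Type*} [MetricSpace X] {F : Set (Finset ℕ)} {x : F → X}
    {M L : Set ℕ} (h : PlegmaClose F x M) (hL : L ⊆ M) : PlegmaClose F x L := fun ε hε => by
  obtain ⟨m, hm⟩ := h ε hε
  exact ⟨m, fun s t hs ht => hm s t (hs.trans hL) (ht.trans hL)⟩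

/-- A finite subset of the range of `ψ` followed by a final segment of `ψ`. -/
theorem exists_strictMono_extension {ψ : ℕ → ℕ} {s : Finset ℕ}
    (hs : (s : Set ℕ) ⊆ Set.range ψ) : ∃ K₀, ∀ K ≥ K₀, ∃ (b : ℕ → ℕ) (n : ℕ), StrictMono b ∧
      (Finset.range n).image (fun i => ψ (b i)) = s ∧ ∀ j, b (n + j) = K + j := by
  obtain ⟨r, -, rfl⟩ := (Finset.subset_set_image_iff (f := ψ) (s := Set.univ) (t := s)).1
    (by rwa [Set.image_univ])
  refine ⟨r.sup id + 1, fun K hK =>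
    ⟨fun k => if k < r.card then elt (r : Set ℕ) k else K + (k - r.card), r.card, ?_, ?_, ?_⟩⟩
  · refine strictMono_nat_of_lt_succ fun k => ?_
    by_cases h1 : k < r.card
    · have hmem : elt (r : Set ℕ) k ∈ r := by
        have := Finset.mem_image_of_mem (elt (r : Set ℕ)) (Finset.mem_range.2 h1)
        rwa [image_elt_range r] at this
      have hle := Finset.le_sup (f := id) hmem
      simp only [id] at hle
      by_cases h2 : k + 1 < r.card
      · simp only [h1, h2, if_true]
        exact strictMonoOn_elt r h1 h2 (Nat.lt_succ_self k)
      · simp only [h1, h2, if_true, if_false]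
        omega
    · have h2 : ¬ k + 1 < r.card := by omega
      simp only [h1, h2, if_false]
      omega
  · conv_rhs => rw [← image_elt_range r, Finset.image_image]
    refine Finset.image_congr fun i hi => ?_
    have : i < r.card := by simpa using hi
    simp [this]
  · intro j
    simp

/-- Thin out to `φ` so that a plegma pair starting at `φ i` costs at most `(1 / 2) ^ i`, and keep
only the odd positions. Extend `s` and `t` to sequences with a common tail; shifting a sequence past
its finite part leads to the same member `u` from both sides. -/
theorem PlegmaClose.exists_cauchyAlong {X : Type*} [MetricSpace X] {F : Set (Finset ℕ)}
    (hF : RegularThin F) (hne : F.Nonempty) (hempty : ∅ ∉ F) {x : F → X} {M : Set ℕ}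
    (hM : M.Infinite) (hx : PlegmaClose F x M) :
    ∃ L ⊆ M, L.Infinite ∧ Large F L ∧ CauchyAlong F x L := by
  obtain ⟨N, hNM, hN, hlarge⟩ := hF.exists_large hne hM
  choose m hm using fun i : ℕ => (hx.mono hNM) ((1 / 2) ^ i) (by positivity)
  obtain ⟨φ, hφ, hφN⟩ := extraction_forall_of_frequently
    (P := fun i k => k ∈ N ∧ m i ≤ k) fun i =>
      (Nat.frequently_atTop_iff_infinite.2 hN).and_eventually (eventually_ge_atTop (m i))
  have hstep : ∀ (b c : ℕ → ℕ) (s t : F) (n n' : ℕ), (∀ k, b k < c k) → (∀ k, c k < b (k + 1)) →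
      (Finset.range n).image (fun i => φ (b i)) = s →
      (Finset.range n').image (fun i => φ (c i)) = t → dist (x s) (x t) < (1 / 2) ^ (b 0) := by
    intro b c s t n n' hbc hcb hs ht
    have hb : StrictMono b := strictMono_nat_of_lt_succ fun k => (hbc k).trans (hcb k)
    refine hm (b 0) s t ?_ ?_ ?_ ?_
    · rw [← hs]
      intro i hi
      obtain ⟨k, -, rfl⟩ := Finset.mem_image.1 (Finset.mem_coe.1 hi)
      exact (hφN _).1
    · rw [← ht]
      intro i hi
      obtain ⟨k, -, rfl⟩ := Finset.mem_image.1 (Finset.mem_coe.1 hi)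
      exact (hφN _).1
    · rw [← hs]
      intro i hi
      obtain ⟨k, -, rfl⟩ := Finset.mem_image.1 hi
      exact (hφN _).2.trans (hφ.monotone (hb.monotone (Nat.zero_le k)))
    · have hn : 0 < n := pos_of_image_range_mem hempty (hs ▸ s.2)
      have hn' : 0 < n' := pos_of_image_range_mem hempty (ht ▸ t.2)
      rw [← hs, ← ht]
      exact plegma_pair_image_range hn hn' (fun k => hφ (hbc k)) fun k => hφ (hcb k)
  have hexists : ∀ c : ℕ → ℕ, StrictMono c → ∃ (u : F) (n : ℕ),
      (Finset.range n).image (fun i => φ (c i)) = u := fun c hc => by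
    obtain ⟨n, hn⟩ := hlarge (fun i => φ (c i)) (hφ.comp hc) fun i => (hφN _).1
    exact ⟨⟨_, hn⟩, n, rfl⟩
  have hpath : ∀ (k : ℕ) (b : ℕ → ℕ) (s t : F) (n n' : ℕ), StrictMono b →
      (Finset.range n).image (fun i => φ (2 * b i + 1)) = s →
      (Finset.range n').image (fun i => φ (2 * b (k + 1 + i) + 1)) = t →
      dist (x s) (x t) ≤ 2 * (1 / 2) ^ (b 0) := by
    intro k
    -- A sequence and its shift share entries, so they are not plegma. The even positions, left free
    -- for this purpose, supply an intermediate member `v` strictly between them.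
    have hshift : ∀ (b : ℕ → ℕ) (s t : F) (n n' : ℕ), StrictMono b →
        (Finset.range n).image (fun i => φ (2 * b i + 1)) = s →
        (Finset.range n').image (fun i => φ (2 * b (i + 1) + 1)) = t →
        dist (x s) (x t) ≤ (1 / 2) ^ (b 0) := by
      intro b s t n n' hb hs ht
      have hb1 : ∀ i, b i < b (i + 1) := fun i => hb (Nat.lt_succ_self i)
      obtain ⟨v, r, hv⟩ := hexists (fun i => 2 * b (i + 1)) fun i j hij => by
        have := hb (Nat.add_lt_add_right hij 1)
        simp only
        omega
      have h1 := hstep (fun i => 2 * b i + 1) (fun i => 2 * b (i + 1)) s v n r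
        (fun i => by have := hb1 i; omega) (fun i => by omega) hs hv
      have h2 := hstep (fun i => 2 * b (i + 1)) (fun i => 2 * b (i + 1) + 1) v t r n'
        (fun i => by omega)
        (fun i => by have := hb1 (i + 1); omega) hv ht
      have h3 : ((1 : ℝ) / 2) ^ (2 * b 0 + 1) ≤ (1 / 2) ^ (b 0 + 1) :=
        pow_le_pow_of_le_one (by norm_num) (by norm_num) (by omega)
      have h4 : ((1 : ℝ) / 2) ^ (2 * b (0 + 1)) ≤ (1 / 2) ^ (b 0 + 1) :=
        pow_le_pow_of_le_one (by norm_num) (by norm_num) (by have := hb1 0; omega)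
      have h5 := dist_triangle (x s) (x v) (x t)
      rw [pow_succ _ (b 0)] at h3 h4
      linarith
    induction k with
    | zero =>
      intro b s t n n' hb hs ht
      have := hshift b s t n n' hb hs (by simpa [add_comm] using ht)
      have h0 : (0 : ℝ) < (1 / 2) ^ (b 0) := by positivity
      linarith
    | succ k ih =>
      intro b s t n n' hb hs ht
      have hb' : StrictMono fun i => b (i + 1) := fun i j hij => hb (Nat.add_lt_add_right hij 1)
      obtain ⟨v, r, hv⟩ := hexists (fun i => 2 * b (i + 1) + 1) fun i j hij => by
        have := hb' hij
        simp only at this ⊢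
        omega
      have h1 := hshift b s v n r hb hs hv
      have h2 := ih (fun i => b (i + 1)) v t r n' hb' hv (by
        rw [← ht]
        refine Finset.image_congr fun i _ => ?_
        rw [show k + 1 + i + 1 = k + 1 + 1 + i by omega])
      -- Since `b 1 ≥ b 0 + 1`, the bound `2 * (1 / 2) ^ (b 1)` for the remaining shifts is at most
      -- `(1 / 2) ^ (b 0)`, which closes the geometric sum.
      have h3 : ((1 : ℝ) / 2) ^ b (0 + 1) ≤ (1 / 2) ^ (b 0 + 1) :=
        pow_le_pow_of_le_one (by norm_num) (by norm_num) (hb (Nat.lt_succ_self 0))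
      rw [pow_succ _ (b 0)] at h3
      have h5 := dist_triangle (x s) (x v) (x t)
      linarith
  let ψ : ℕ → ℕ := fun i => φ (2 * i + 1)
  have hψ : StrictMono ψ := fun i j hij => hφ (by omega)
  have hψinf : (Set.range ψ).Infinite := Set.infinite_range_of_injective hψ.injective
  have hψN : Set.range ψ ⊆ N := by
    rintro _ ⟨i, rfl⟩
    exact (hφN _).1
  refine ⟨Set.range ψ, hψN.trans hNM, hψinf, hlarge.mono hψN, fun ε hε => ?_⟩
  obtain ⟨m₀, hm₀⟩ := exists_pow_lt_of_lt_one (show 0 < ε / 4 by positivity)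
    (show (1 / 2 : ℝ) < 1 by norm_num)
  have hdist : ∀ (s u : F) (b : ℕ → ℕ) (n n' K : ℕ), StrictMono b →
      (Finset.range n).image (fun i => ψ (b i)) = s → (∀ j, b (n + j) = K + j) →
      (Finset.range n').image (fun i => ψ (K + i)) = u →
      (∀ i ∈ (s : Finset ℕ), elt (Set.range ψ) (ψ m₀) ≤ i) →
      dist (x s) (x u) < ε / 2 := by
    intro s u b n n' K hb hs hbK hu hmin
    have hn : 0 < n := pos_of_image_range_mem hempty (hs ▸ s.2)
    have h0 : m₀ ≤ b 0 := by
      refine hψ.le_iff_le.1 ((le_elt_of_infinite hψinf (ψ m₀)).trans (hmin _ ?_))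
      rw [← hs]
      exact Finset.mem_image_of_mem (fun i => ψ (b i)) (Finset.mem_range.2 hn)
    -- As many shifts as `s` has elements leave exactly the tail starting at `K`.
    obtain ⟨k, rfl⟩ := Nat.exists_eq_succ_of_ne_zero hn.ne'
    have h1 := hpath k b s u _ n' hb hs (by
      rw [← hu]
      refine Finset.image_congr fun i _ => ?_
      simp only [ψ]
      rw [← hbK])
    have h2 : ((1 : ℝ) / 2) ^ b 0 ≤ (1 / 2) ^ m₀ :=
      pow_le_pow_of_le_one (by norm_num) (by norm_num) h0
    linarith
  refine ⟨ψ m₀, fun s t hs ht hsm htm => ?_⟩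
  obtain ⟨K₁, h₁⟩ := exists_strictMono_extension hs
  obtain ⟨K₂, h₂⟩ := exists_strictMono_extension ht
  obtain ⟨b, n, hb, hbs, hbK⟩ := h₁ (max K₁ K₂) (le_max_left _ _)
  obtain ⟨c, n', hc, hct, hcK⟩ := h₂ (max K₁ K₂) (le_max_right _ _)
  obtain ⟨u, r, hu⟩ := hexists (fun i => 2 * (max K₁ K₂ + i) + 1) fun i j hij => by
    simp only
    omega
  have h1 := hdist s u b n r _ hb hbs hbK hu hsm
  have h2 := hdist t u c n' r _ hc hct hcK hu htm
  have h3 := dist_triangle_right (x s) (x t) (x u)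
  linarith

theorem CauchyAlong.exists_convergesAlong {X : Type*} [MetricSpace X] [CompleteSpace X]
    {F : Set (Finset ℕ)} (hempty : ∅ ∉ F) {x : F → X} {L : Set ℕ} (hL : L.Infinite)
    (hlarge : Large F L) (hx : CauchyAlong F x L) : ∃ x₀, ConvergesAlong F x L x₀ := by
  -- A tuple of length one is merely a member of `F` far out in `L`.
  choose s hsL hsp hs using fun m : ℕ => hlarge.exists_plegma hL hempty 1 (elt L m)
  have hmono := Nat.nth_strictMono (p := fun n => n ∈ L) hL
  have hcau : CauchySeq fun m => x (s m 0) := by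
    rw [Metric.cauchySeq_iff]
    intro ε hε
    obtain ⟨m, hm⟩ := hx ε hε
    exact ⟨m, fun i hi j hj => hm _ _ (hsL i 0) (hsL j 0)
      (fun n hn => (hmono.monotone hi).trans (hs i 0 n hn))
      fun n hn => (hmono.monotone hj).trans (hs j 0 n hn)⟩
  obtain ⟨x₀, hx₀⟩ := cauchySeq_tendsto_of_complete hcau
  refine ⟨x₀, fun U hU hxU => ?_⟩
  obtain ⟨ε, hε, hball⟩ := Metric.isOpen_iff.1 hU x₀ hxU
  obtain ⟨m, hm⟩ := hx (ε / 2) (by positivity)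
  refine ⟨m, fun t ht htm => hball ?_⟩
  have hle : dist (x t) x₀ ≤ ε / 2 := by
    refine le_of_tendsto (tendsto_const_nhds.dist hx₀) ?_
    filter_upwards [eventually_ge_atTop m] with i hi
    exact (hm t (s i 0) ht (hsL i 0) htm
      fun n hn => (hmono.monotone hi).trans (hs i 0 n hn)).le
  exact Metric.mem_ball.2 (by linarith)

theorem ConvergesAlong.cauchyAlong {X : Type*} [MetricSpace X] {F : Set (Finset ℕ)} {x : F → X}
    {L : Set ℕ} {x₀ : X} (hx : ConvergesAlong F x L x₀) : CauchyAlong F x L := fun ε hε => by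
  obtain ⟨m, hm⟩ := hx _ (Metric.isOpen_ball (x := x₀) (ε := ε / 2))
    (Metric.mem_ball_self (by positivity))
  refine ⟨m, fun s t hs ht hsm htm => ?_⟩
  have h1 := Metric.mem_ball.1 (hm s hs hsm)
  have h2 := Metric.mem_ball.1 (hm t ht htm)
  have h3 := dist_triangle_right (x s) (x t) x₀
  linarith

/-- Take an increasing sequence that alternates between `L` and `L'`. The two sets may be unrelated,
which lets limits along different sets be compared. -/
theorem exists_plegma_pair {F : Set (Finset ℕ)} (hempty : ∅ ∉ F) {L L' : Set ℕ}
    (hL : L.Infinite) (hlarge : Large F L) (hL' : L'.Infinite) (hlarge' : Large F L') (m : ℕ) :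
    ∃ s t : F, ((s : Finset ℕ) : Set ℕ) ⊆ L ∧ ((t : Finset ℕ) : Set ℕ) ⊆ L' ∧
      (∀ n ∈ (s : Finset ℕ), m ≤ n) ∧ (∀ n ∈ (t : Finset ℕ), m ≤ n) ∧
      Plegma ![(s : Finset ℕ), (t : Finset ℕ)] := by
  obtain ⟨c, hc, hcP⟩ := extraction_forall_of_frequently
    (P := fun i k => k ∈ (if Even i then L else L') ∧ m ≤ k) fun i => by
      refine (Nat.frequently_atTop_iff_infinite.2 ?_).and_eventually (eventually_ge_atTop m)
      split_ifs
      exacts [hL, hL']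
  have hcL : ∀ i, c (2 * i) ∈ L := fun i => by simpa using (hcP (2 * i)).1
  have hcL' : ∀ i, c (2 * i + 1) ∈ L' := fun i => by simpa using (hcP (2 * i + 1)).1
  obtain ⟨n, hn⟩ := hlarge (fun i => c (2 * i)) (fun i j hij => hc (by omega)) hcL
  obtain ⟨n', hn'⟩ := hlarge' (fun i => c (2 * i + 1)) (fun i j hij => hc (by omega)) hcL'
  refine ⟨⟨_, hn⟩, ⟨_, hn'⟩, ?_, ?_, ?_, ?_, ?_⟩
  · intro i hi
    obtain ⟨k, -, rfl⟩ := Finset.mem_image.1 (Finset.mem_coe.1 hi)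
    exact hcL k
  · intro i hi
    obtain ⟨k, -, rfl⟩ := Finset.mem_image.1 (Finset.mem_coe.1 hi)
    exact hcL' k
  · intro i hi
    obtain ⟨k, -, rfl⟩ := Finset.mem_image.1 hi
    exact (hcP _).2
  · intro i hi
    obtain ⟨k, -, rfl⟩ := Finset.mem_image.1 hi
    exact (hcP _).2
  · exact plegma_pair_image_range (pos_of_image_range_mem hempty hn)
      (pos_of_image_range_mem hempty hn') (fun k => hc (by omega)) fun k => hc (by omega)

/-- The limit does not depend on the subset: a plegma pair with one entry in `N` and the other in
`L'` has close terms, each near its own limit. -/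
theorem PlegmaClose.exists_common_limit {X : Type*} [MetricSpace X] [CompleteSpace X]
    {F : Set (Finset ℕ)} (hF : RegularThin F) (hne : F.Nonempty) (hempty : ∅ ∉ F) {x : F → X}
    {M : Set ℕ} (hM : M.Infinite) (hx : PlegmaClose F x M) :
    ∃ x₀ : X, ∀ L : Set ℕ, L ⊆ M → L.Infinite →
      ∃ L' : Set ℕ, L' ⊆ L ∧ L'.Infinite ∧ ConvergesAlong F x L' x₀ := by
  obtain ⟨N, hNM, hN, hNlarge, hNc⟩ := hx.exists_cauchyAlong hF hne hempty hM
  obtain ⟨x₀, hx₀⟩ := hNc.exists_convergesAlong hempty hN hNlarge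
  refine ⟨x₀, fun L hLM hL => ?_⟩
  obtain ⟨L', hL'L, hL', hlarge', hc'⟩ := (hx.mono hLM).exists_cauchyAlong hF hne hempty hL
  obtain ⟨x₁, hx₁⟩ := hc'.exists_convergesAlong hempty hL' hlarge'
  suffices h : x₀ = x₁ from ⟨L', hL'L, hL', h ▸ hx₁⟩
  refine eq_of_forall_dist_le fun ε hε => ?_
  obtain ⟨m, hm⟩ := hx (ε / 3) (by positivity)
  obtain ⟨m₀, hm₀⟩ := hx₀ _ (Metric.isOpen_ball (x := x₀) (ε := ε / 3))
    (Metric.mem_ball_self (by positivity))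
  obtain ⟨m₁, hm₁⟩ := hx₁ _ (Metric.isOpen_ball (x := x₁) (ε := ε / 3))
    (Metric.mem_ball_self (by positivity))
  obtain ⟨s, t, hs, ht, hsm, htm, hst⟩ := exists_plegma_pair hempty hN hNlarge hL' hlarge'
    (max m (max (elt N m₀) (elt L' m₁)))
  simp only [max_le_iff] at hsm htm
  have h1 := hm s t (hs.trans hNM) (ht.trans (hL'L.trans hLM)) (fun n hn => (hsm n hn).1) hst
  have h2 := Metric.mem_ball'.1 (hm₀ s hs fun n hn => (hsm n hn).2.1)
  have h3 := Metric.mem_ball.1 (hm₁ t ht fun n hn => (htm n hn).2.2)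
  have h4 := dist_triangle4 x₀ (x s) (x t) x₁
  linarith


/-! ### Spreading models and the number `p (e 0 - e 1)` -/

section

variable {X : Type*} [NormedAddCommGroup X] [NormedSpace ℝ X] {E : Type*} [AddCommGroup E]
  [Module ℝ E] {p : Seminorm ℝ E} {e : ℕ → E} {F : Set (Finset ℕ)} {x : F → X} {M : Set ℕ}

theorem Generates.exists_abs_sub_le (hgen : Generates p e F x M) (k : ℕ) {ε : ℝ} (hε : 0 < ε) :
    ∃ m : ℕ, ∀ s : Fin (k + 1) → F, (∀ j, ((s j : Finset ℕ) : Set ℕ) ⊆ M) →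
      Plegma (fun j => (s j : Finset ℕ)) → (∀ n ∈ (s 0 : Finset ℕ), m ≤ n) →
      ∀ a : Fin (k + 1) → ℝ, (∀ j, a j ∈ Set.Icc (-1 : ℝ) 1) →
        |‖∑ j, a j • x (s j)‖ - p (∑ j, a j • e j)| ≤ ε := by
  obtain ⟨δ, -, hδ, h⟩ := hgen
  obtain ⟨l, hl, hkl⟩ := ((hδ.eventually_le_const hε).and (eventually_ge_atTop k)).exists
  exact ⟨elt M l, fun s hs hp hm a ha => (h k l hkl s hs hp hm a ha).trans hl⟩

theorem Generates.exists_abs_dist_sub_le (hgen : Generates p e F x M) {ε : ℝ} (hε : 0 < ε) :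
    ∃ m : ℕ, ∀ s t : F, ((s : Finset ℕ) : Set ℕ) ⊆ M → ((t : Finset ℕ) : Set ℕ) ⊆ M →
      (∀ n ∈ (s : Finset ℕ), m ≤ n) → Plegma ![(s : Finset ℕ), (t : Finset ℕ)] →
        |dist (x s) (x t) - p (e 0 - e 1)| ≤ ε := by
  obtain ⟨m, hm⟩ := hgen.exists_abs_sub_le 1 hε
  refine ⟨m, fun s t hs ht hsm hst => ?_⟩
  have := hm ![s, t] (by simp [Fin.forall_fin_two, hs, ht]) (by
    convert hst using 1
    ext i : 1
    fin_cases i <;> rfl) hsm ![1, -1] (Fin.forall_fin_two.2 (by norm_num))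
  simpa [Fin.sum_univ_two, ← sub_eq_add_neg, ← dist_eq_norm] using this

theorem Generates.plegmaClose (hgen : Generates p e F x M) (h0 : p (e 0 - e 1) = 0) :
    PlegmaClose F x M := fun ε hε => by
  obtain ⟨m, hm⟩ := hgen.exists_abs_dist_sub_le (half_pos hε)
  refine ⟨m, fun s t hs ht hsm hst => ?_⟩
  have := (abs_le.1 (hm s t hs ht hsm hst)).2
  rw [h0] at this
  linarith

theorem Generates.seminorm_sub_eq_zero_of_cauchyAlong (hF : RegularThin F) (hne : F.Nonempty)
    (hempty : ∅ ∉ F) (hgen : Generates p e F x M) {L : Set ℕ} (hLM : L ⊆ M) (hL : L.Infinite)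
    (hx : CauchyAlong F x L) : p (e 0 - e 1) = 0 := by
  refine le_antisymm (le_of_forall_pos_le_add fun ε hε => ?_) (apply_nonneg p _)
  obtain ⟨m, hm⟩ := hgen.exists_abs_dist_sub_le (half_pos hε)
  obtain ⟨m', hm'⟩ := hx (ε / 2) (half_pos hε)
  obtain ⟨N, hNL, hN, hlarge⟩ := hF.exists_large hne hL
  obtain ⟨s, hs, hsp, hsm⟩ := hlarge.exists_plegma hN hempty 2 (max m (elt L m'))
  simp only [max_le_iff] at hsm
  have h1 := hm (s 0) (s 1) (((hs 0).trans hNL).trans hLM) (((hs 1).trans hNL).trans hLM)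
    (fun n hn => (hsm 0 n hn).1) (hsp.pair Fin.zero_lt_one)
  have h2 := hm' (s 0) (s 1) ((hs 0).trans hNL) ((hs 1).trans hNL)
    (fun n hn => (hsm 0 n hn).2) (fun n hn => (hsm 1 n hn).2)
  have := (abs_le.1 h1).1
  linarith

theorem Generates.exists_plegmaSeparated (hM : M.Infinite)
    (hgen : Generates p e F x M) (h0 : p (e 0 - e 1) ≠ 0) :
    ∃ ε > 0, ∃ L ⊆ M, L.Infinite ∧ PlegmaSeparated ε F x L := by
  have hpos : 0 < p (e 0 - e 1) := lt_of_le_of_ne (apply_nonneg p _) h0.symm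
  obtain ⟨m, hm⟩ := hgen.exists_abs_dist_sub_le (show 0 < p (e 0 - e 1) / 3 by positivity)
  -- Deleting the elements below `m` makes every pair far out, with distance at least two thirds of
  -- `p (e 0 - e 1)`.
  refine ⟨p (e 0 - e 1) / 3, by positivity, M \ Set.Iio m, Set.sdiff_subset,
    hM.sdiff (Set.finite_Iio m), fun s t hs ht hst => ?_⟩
  have := (abs_le.1 (hm s t (hs.trans Set.sdiff_subset) (ht.trans Set.sdiff_subset)
    (fun n hn => not_lt.1 (hs hn).2) hst)).1
  linarith

theorem Generates.not_plegmaSeparated (hF : RegularThin F) (hne : F.Nonempty)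
    (hempty : ∅ ∉ F) (hgen : Generates p e F x M) (h0 : p (e 0 - e 1) = 0) {ε : ℝ} (hε : 0 < ε)
    {L : Set ℕ} (hLM : L ⊆ M) (hL : L.Infinite) : ¬ PlegmaSeparated ε F x L := fun hsep => by
  obtain ⟨m, hm⟩ := hgen.plegmaClose h0 ε hε
  obtain ⟨N, hNL, hN, hlarge⟩ := hF.exists_large hne hL
  obtain ⟨s, hs, hsp, hsm⟩ := hlarge.exists_plegma hN hempty 2 m
  have hpair := hsp.pair (i := 0) (j := 1) Fin.zero_lt_one
  exact lt_asymm (hm (s 0) (s 1) (((hs 0).trans hNL).trans hLM) (((hs 1).trans hNL).trans hLM)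
    (hsm 0) hpair) (hsep (s 0) (s 1) ((hs 0).trans hNL) ((hs 1).trans hNL) hpair)

/-- From a plegma tuple with `k + 2` entries, omit either entry `i + 1` or entry `i`. Both
combinations are nearly zero in norm, and their difference is `a i` times the difference of the
terms at these two entries. -/
theorem Generates.seminorm_sub_eq_zero_of_seminorm_sum_eq_zero (hF : RegularThin F)
    (hne : F.Nonempty) (hempty : ∅ ∉ F) (hM : M.Infinite) (hgen : Generates p e F x M) {k : ℕ}
    {a : Fin (k + 1) → ℝ} (ha : p (∑ j, a j • e j) = 0) {i : Fin (k + 1)} (hi : a i ≠ 0) :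
    p (e 0 - e 1) = 0 := by
  -- Dividing by the sup norm brings the coefficients into the range covered by `Generates`.
  wlog hbound : ∀ j, a j ∈ Set.Icc (-1 : ℝ) 1 generalizing a
  · have hC : 0 < ‖a‖ := by
      rw [norm_pos_iff]
      exact fun h => hi (congrFun h i)
    refine this (a := ‖a‖⁻¹ • a) ?_ (by simp [hi, hC.ne']) fun j => ?_
    · simp only [Pi.smul_apply, smul_assoc, ← Finset.smul_sum, map_smul_eq_mul, ha, mul_zero]
    · rw [Set.mem_Icc, ← abs_le, Pi.smul_apply, smul_eq_mul, abs_mul, abs_inv, abs_norm,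
        inv_mul_le_one₀ hC]
      exact norm_le_pi_norm a j
  have hpos : 0 < |a i| := abs_pos.2 hi
  refine le_antisymm (le_of_forall_pos_le_add fun ε hε => ?_) (apply_nonneg p _)
  obtain ⟨m, hm⟩ := hgen.exists_abs_dist_sub_le (half_pos hε)
  obtain ⟨m', hm'⟩ := hgen.exists_abs_sub_le k (show 0 < |a i| * (ε / 4) by positivity)
  obtain ⟨N, hNM, hN, hlarge⟩ := hF.exists_large hne hM
  obtain ⟨s, hs, hsp, hsm⟩ := hlarge.exists_plegma hN hempty (k + 2) (max m m')
  simp only [max_le_iff] at hsm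
  have hsum : ∀ q : Fin (k + 2), ‖∑ j, a j • x (s (q.succAbove j))‖ ≤ |a i| * (ε / 4) :=
    fun q => by
      have := hm' (fun j => s (q.succAbove j)) (fun j => (hs _).trans hNM)
        (hsp.comp (Fin.strictMono_succAbove q)) (fun n hn => (hsm _ n hn).2) a hbound
      rw [ha, sub_zero, abs_norm] at this
      exact this
  have hdiff : ∑ j, a j • x (s (i.succ.succAbove j)) - ∑ j, a j • x (s (i.castSucc.succAbove j))
      = a i • (x (s i.castSucc) - x (s i.succ)) := by
    rw [← Finset.sum_sub_distrib, Finset.sum_eq_single i]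
    · rw [smul_sub, Fin.succAbove_succ_self, Fin.succAbove_castSucc_self]
    · intro j _ hji
      rcases lt_or_gt_of_ne hji with h | h
      · rw [Fin.succAbove_of_castSucc_lt _ _ (Fin.castSucc_lt_succ_iff.2 h.le),
          Fin.succAbove_of_castSucc_lt _ _ (by simpa using h), sub_self]
      · rw [Fin.succAbove_of_le_castSucc _ _ (Fin.succ_le_castSucc_iff.2 h),
          Fin.succAbove_of_le_castSucc _ _ (by simpa using h.le), sub_self]
    · simp
  have h1 := norm_sub_le (∑ j, a j • x (s (i.succ.succAbove j)))
    (∑ j, a j • x (s (i.castSucc.succAbove j)))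
  rw [hdiff, norm_smul, ← dist_eq_norm, Real.norm_eq_abs] at h1
  have h2 : |a i| * dist (x (s i.castSucc)) (x (s i.succ)) ≤ |a i| * (ε / 2) := by
    have h3 := hsum i.succ
    have h4 := hsum i.castSucc
    linarith
  have h5 := le_of_mul_le_mul_left h2 hpos
  have h6 := (abs_le.1 (hm (s i.castSucc) (s i.succ) ((hs _).trans hNM) ((hs _).trans hNM)
    (fun n hn => (hsm _ n hn).1) (hsp.pair Fin.castSucc_lt_succ))).1
  linarith

/-- The first and last entries of a plegma tuple of length `i + 1` themselves form a plegma pair, so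
their terms are close; the coefficients `-1, 0, …, 0, 1` transfer this to `e i - e 0`. -/
theorem Generates.seminorm_sub_zero_eq_zero (hF : RegularThin F) (hne : F.Nonempty)
    (hempty : ∅ ∉ F) (hM : M.Infinite) (hgen : Generates p e F x M) (h0 : p (e 0 - e 1) = 0)
    (i : ℕ) : p (e i - e 0) = 0 := by
  rcases Nat.eq_zero_or_pos i with rfl | hi
  · simp
  refine le_antisymm (le_of_forall_pos_le_add fun ε hε => ?_) (apply_nonneg p _)
  obtain ⟨m, hm⟩ := hgen.plegmaClose h0 (ε / 2) (half_pos hε)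
  obtain ⟨m', hm'⟩ := hgen.exists_abs_sub_le i (half_pos hε)
  obtain ⟨N, hNM, hN, hlarge⟩ := hF.exists_large hne hM
  obtain ⟨s, hs, hsp, hsm⟩ := hlarge.exists_plegma hN hempty (i + 1) (max m m')
  simp only [max_le_iff] at hsm
  have hlast : (0 : Fin (i + 1)) < Fin.last i := by
    rw [Fin.lt_def]
    simpa using hi
  have h1 := hm (s 0) (s (Fin.last i)) ((hs _).trans hNM) ((hs _).trans hNM)
    (fun n hn => (hsm _ n hn).1) (hsp.pair hlast)
  have h2 := hm' s (fun j => (hs j).trans hNM) hsp (fun n hn => (hsm _ n hn).2)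
    (Pi.single (Fin.last i) 1 - Pi.single 0 1) (fun j => by
      rcases eq_or_ne j 0 with rfl | hj0
      · simp [hlast.ne]
      · by_cases hjl : j = Fin.last i <;> simp [hj0, hjl, hlast.ne'])
  simp only [Pi.sub_apply, sub_smul, Finset.sum_sub_distrib, Pi.single_apply, ite_smul, one_smul,
    zero_smul, Finset.sum_ite_eq', Finset.mem_univ, if_true, Fin.val_last, Fin.val_zero] at h2
  rw [← dist_eq_norm, dist_comm] at h2
  have h3 := (abs_le.1 h2).1
  linarith

theorem trivialSeq_of_seminorm_sub_zero_eq_zero (h : ∀ i, p (e i - e 0) = 0) :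
    TrivialSeq p e := fun n a => by
  have h0 : p (∑ i, a i • e i - (∑ i, a i) • e 0) = 0 := by
    rw [Finset.sum_smul, ← Finset.sum_sub_distrib]
    refine le_antisymm ?_ (apply_nonneg p _)
    refine (Finset.le_sum_of_subadditive p (map_zero p).le (map_add_le_add p) _ _).trans
      (Finset.sum_nonpos fun i _ => ?_)
    rw [← smul_sub, map_smul_eq_mul, h, mul_zero]
  have h1 := abs_sub_map_le_sub p (∑ i, a i • e i) ((∑ i, a i) • e 0)
  rw [h0, map_smul_eq_mul, Real.norm_eq_abs] at h1
  exact sub_eq_zero.1 (abs_eq_zero.1 (le_antisymm h1 (abs_nonneg _)))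

theorem TrivialSeq.seminorm_sub_eq_zero (h : TrivialSeq p e) : p (e 0 - e 1) = 0 := by
  simpa [Fin.sum_univ_two, ← sub_eq_add_neg] using h 2 ![1, -1]

theorem TrivialSeq.generates_const (h : TrivialSeq p e) {y : F → X} (hy : ∃ c, ∀ t, y t = c)
    (hnorm : ∀ t, ‖y t‖ = p (e 0)) : Generates p e F y M := by
  obtain ⟨c, hc⟩ := hy
  refine ⟨fun n => 1 / ((n : ℝ) + 1), fun n => Nat.one_div_pos_of_nat,
    tendsto_one_div_add_atTop_nhds_zero_nat, fun k l _ s _ _ _ a _ => ?_⟩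
  have hc' : ‖c‖ = p (e 0) := hc (s 0) ▸ hnorm (s 0)
  rw [h (k + 1) a]
  simp only [hc, ← Finset.sum_smul, norm_smul, hc', Real.norm_eq_abs, sub_self, abs_zero]
  exact Nat.one_div_pos_of_nat.le

theorem Generates.trivialSeq_of_const (hF : RegularThin F) (hne : F.Nonempty) (hempty : ∅ ∉ F)
    (hM : M.Infinite) {c : X} (hgen : Generates p e F (fun _ => c) M) : TrivialSeq p e := by
  have hx : CauchyAlong F (fun _ : F => c) M := fun ε hε => ⟨0, fun _ _ _ _ _ _ => by simpa⟩
  exact trivialSeq_of_seminorm_sub_zero_eq_zero (hgen.seminorm_sub_zero_eq_zero hF hne hempty hM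
    (hgen.seminorm_sub_eq_zero_of_cauchyAlong hF hne hempty subset_rfl hM hx))

end

/-! ### Basis expansions, a test space and the equivalences -/

theorem exists_sum_fin_smul_eq {E : Type*} [AddCommGroup E] [Module ℝ E]
    (e : Module.Basis ℕ ℝ E) {z : E} (hz : z ≠ 0) :
    ∃ (k : ℕ) (a : Fin (k + 1) → ℝ) (i : Fin (k + 1)), a i ≠ 0 ∧ ∑ j, a j • e j = z := by
  have hr : e.repr z ≠ 0 := by simpa using hz
  obtain ⟨i, hi⟩ := Finsupp.ne_iff.1 hr
  let k := (e.repr z).support.sup id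
  have hmem : ∀ j ∈ (e.repr z).support, j ∈ Finset.range (k + 1) := fun j hj =>
    Finset.mem_range.2 (Nat.lt_succ_of_le (Finset.le_sup (f := id) hj))
  refine ⟨k, fun j => e.repr z j,
    ⟨i, Finset.mem_range.1 (hmem i (Finsupp.mem_support_iff.2 hi))⟩, hi, ?_⟩
  rw [Fin.sum_univ_eq_sum_range (fun j => e.repr z j • e j)]
  conv_rhs => rw [← e.linearCombination_repr z, Finsupp.linearCombination_apply]
  exact (Finsupp.sum_of_support_subset _ hmem (fun j c => c • e j) (by simp)).symm

-- Provides an infinite-dimensional Banach space in the universe over which the third condition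
-- quantifies.
open scoped lp in
theorem not_finiteDimensional_l2 : ¬ FiniteDimensional ℝ ℓ²(ULift.{w} ℕ, ℝ) := fun h => by
  have b : HilbertBasis (ULift.{w} ℕ) ℝ ℓ²(ULift.{w} ℕ, ℝ) :=
    HilbertBasis.ofRepr (LinearIsometryEquiv.refl ℝ _)
  exact not_finite_iff_infinite.2 inferInstance
    b.orthonormal.linearIndependent.finite_of_isNoetherian

end FSpreading

theorem mainTheorem4 {X : Type u} [NormedAddCommGroup X] [NormedSpace ℝ X]
    [CompleteSpace X] {E : Type v} [AddCommGroup E] [Module ℝ E] (p : Seminorm ℝ E)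
    (e : Module.Basis ℕ ℝ E) (F : Set (Finset ℕ)) (hF : FSpreading.RegularThin F)
    (hF_ne : F.Nonempty) (hF_empty : ∅ ∉ F) (x : F → X) (M : Set ℕ) (hM : M.Infinite)
    (hgen : FSpreading.Generates p e F x M) :
    List.TFAE [
      ∃ z : E, z ≠ 0 ∧ p z = 0,
      FSpreading.TrivialSeq p e,
      ∀ G : Set (Finset ℕ), FSpreading.RegularThin G →
        ∀ (Y : Type w) [NormedAddCommGroup Y] [NormedSpace ℝ Y] [CompleteSpace Y],
          ¬ FiniteDimensional ℝ Y →
          ∀ y : G → Y, (∃ c, ∀ t, y t = c) → (∀ t, ‖y t‖ = p (e 0)) →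
            FSpreading.Generates p e G y Set.univ,
      ∃ L : Set ℕ, L ⊆ M ∧ L.Infinite ∧ FSpreading.CauchyAlong F x L,
      ∀ ε : ℝ, 0 < ε → ∀ L : Set ℕ, L ⊆ M → L.Infinite →
        ¬ FSpreading.PlegmaSeparated ε F x L,
      ∃ x₀ : X, ∀ L : Set ℕ, L ⊆ M → L.Infinite →
        ∃ L' : Set ℕ, L' ⊆ L ∧ L'.Infinite ∧ FSpreading.ConvergesAlong F x L' x₀] := by
  have htriv : p (e 0 - e 1) = 0 → FSpreading.TrivialSeq p e := fun h0 =>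
    FSpreading.trivialSeq_of_seminorm_sub_zero_eq_zero
      (hgen.seminorm_sub_zero_eq_zero hF hF_ne hF_empty hM h0)
  tfae_have 1 → 2 := by
    rintro ⟨z, hz, hpz⟩
    obtain ⟨k, a, i, hi, rfl⟩ := FSpreading.exists_sum_fin_smul_eq e hz
    exact htriv (hgen.seminorm_sub_eq_zero_of_seminorm_sum_eq_zero hF hF_ne hF_empty hM hpz hi)
  tfae_have 2 → 1 := fun h =>
    ⟨e 0 - e 1, sub_ne_zero.2 (e.injective.ne Nat.zero_ne_one), h.seminorm_sub_eq_zero⟩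
  tfae_have 2 → 3 := fun h G _ Y _ _ _ _ y hy hnorm => h.generates_const hy hnorm
  tfae_have 3 → 2 := fun h => by
    have hinf := FSpreading.not_finiteDimensional_l2.{w}
    have : Nontrivial (lp (fun _ : ULift.{w} ℕ => ℝ) 2) := by
      by_contra hcon
      rw [not_nontrivial_iff_subsingleton] at hcon
      exact hinf inferInstance
    -- The third condition is tested on `F` itself with a constant sequence, which is trivially
    -- Cauchy.
    obtain ⟨c, hc⟩ := exists_norm_eq (lp (fun _ : ULift.{w} ℕ => ℝ) 2) (apply_nonneg p (e 0))
    exact (h F hF _ hinf (fun _ => c) ⟨c, fun _ => rfl⟩ fun _ => hc).trivialSeq_of_const hF hF_ne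
      hF_empty Set.infinite_univ
  tfae_have 2 → 6 := fun h =>
    (hgen.plegmaClose h.seminorm_sub_eq_zero).exists_common_limit hF hF_ne hF_empty hM
  tfae_have 6 → 4 := by
    rintro ⟨x₀, h⟩
    obtain ⟨L, hLM, hL, hx⟩ := h M subset_rfl hM
    exact ⟨L, hLM, hL, hx.cauchyAlong⟩
  tfae_have 4 → 2 := by
    rintro ⟨L, hLM, hL, hx⟩
    exact htriv (hgen.seminorm_sub_eq_zero_of_cauchyAlong hF hF_ne hF_empty hLM hL hx)
  tfae_have 2 → 5 := fun h ε hε L hLM hL =>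
    hgen.not_plegmaSeparated hF hF_ne hF_empty h.seminorm_sub_eq_zero hε hLM hL
  tfae_have 5 → 2 := fun h => htriv <| by
    by_contra h0
    obtain ⟨ε, hε, L, hLM, hL, hsep⟩ := hgen.exists_plegmaSeparated hM h0
    exact h ε hε L hLM hL hsep
  tfae_finish
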